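/- Let $0<q<1$ and let $n$ be an integer. For $z\in\mathbb{C}\setminus\{0\}$ put $$f_n(z)={}_0\phi_1\left({-\atop 0};\,q,\,\frac{q^{2n+1}}{z}\right)=\sum_{k=0}^\infty \frac{q^{k(k-1)}}{(q;q)_k}\left(\frac{q^{2n+1}}{z}\right)^k,\qquad (q;q)_k=\prod_{j=1}^{k}(1-q^j).$$ Then every zero of $f_n$ in $\mathbb{C}\setminus\{0\}$ is real, negative and simple, and the zeros of $f_n$ interlace with the zeros of $f_{n+1}$: the two functions have no common zero, and strictly between any two zeros of one of them there is a zero of the other (so that strictly between two consecutive zeros of either function there is exactly one zero of the other). -/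

import Mathlib

namespace QHyp

/-- The `q`-shifted factorial `(a; q)_k = (1 - a) (1 - a q) ⋯ (1 - a q ^ (k - 1))`. -/
noncomputable def qPoch (q a : ℂ) (k : ℕ) : ℂ :=
  ∏ j ∈ Finset.range k, (1 - a * q ^ j)

/-- The `k`-th term of the basic hypergeometric series `r φ s` with upper parameters `as`
(`r` of them), lower parameters `bs` (`s` of them), base `q` and argument `x`. The exponent
`1 + s - r` is an integer; `k.choose 2` is `k (k - 1) / 2`. -/
noncomputable def phiTerm (as bs : List ℂ) (q x : ℂ) (k : ℕ) : ℂ :=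
  (as.map fun a => qPoch q a k).prod / ((bs.map fun b => qPoch q b k).prod * qPoch q q k) *
    ((-1) ^ k * q ^ k.choose 2) ^ (1 + (bs.length : ℤ) - (as.length : ℤ)) * x ^ k

/-- The basic hypergeometric function `r φ s (as; bs; q, x)`, as the sum of its series. -/
noncomputable def phi (as bs : List ℂ) (q x : ℂ) : ℂ :=
  ∑' k : ℕ, phiTerm as bs q x k

/-- `f_n (z) = 0 φ 1 (-; 0; q, q ^ (2 n + 1) / z)`, for an integer `n` and `z ≠ 0`. -/
noncomputable def f (q : ℝ) (n : ℤ) (z : ℂ) : ℂ :=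
  phi [] [0] (q : ℂ) ((q : ℂ) ^ (2 * n + 1) / z)

/-- The zeros of `f_n` in its domain `ℂ \ {0}`. -/
def zeros (q : ℝ) (n : ℤ) : Set ℂ :=
  {z : ℂ | z ≠ 0 ∧ f q n z = 0}

/-- The real zeros of `f_n`, as a set of real numbers. -/
def realZeros (q : ℝ) (n : ℤ) : Set ℝ :=
  {x : ℝ | (x : ℂ) ∈ zeros q n}

/-- Two sets of real numbers interlace (strictly): they have no common point, and strictly
between any two points of either set there is a point of the other. So strictly between two
consecutive points of either set there is exactly one point of the other, see
`Interlace.existsUnique`. -/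
def Interlace (S T : Set ℝ) : Prop :=
  Disjoint S T ∧
    (∀ a ∈ S, ∀ b ∈ S, a < b → ∃ t ∈ T, a < t ∧ t < b) ∧
    (∀ a ∈ T, ∀ b ∈ T, a < b → ∃ s ∈ S, a < s ∧ s < b)

theorem Interlace.symm {S T : Set ℝ} (h : Interlace S T) : Interlace T S :=
  ⟨h.1.symm, h.2.2, h.2.1⟩

theorem Interlace.existsUnique {S T : Set ℝ} (h : Interlace S T) {a b : ℝ} (ha : a ∈ S)
    (hb : b ∈ S) (hab : a < b) (hcons : ∀ s ∈ S, ¬ (a < s ∧ s < b)) :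
    ∃! t, t ∈ T ∧ a < t ∧ t < b := by
  obtain ⟨t, ht, h1, h2⟩ := h.2.1 a ha b hb hab
  refine ⟨t, ⟨ht, h1, h2⟩, ?_⟩
  rintro u ⟨hu, h3, h4⟩
  rcases lt_trichotomy u t with hlt | heq | hlt
  · obtain ⟨s, hs, h5, h6⟩ := h.2.2 u hu t ht hlt
    exact absurd ⟨h3.trans h5, h6.trans h2⟩ (hcons s hs)
  · exact heq
  · obtain ⟨s, hs, h5, h6⟩ := h.2.2 t ht u hu hlt
    exact absurd ⟨h1.trans h5, h6.trans h4⟩ (hcons s hs)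

/-- The terms of `0 φ 1 (-; 0; q, x)` are `q ^ (k (k - 1)) x ^ k / (q; q)_k`. -/
theorem phiTerm_zero_one (q x : ℂ) (k : ℕ) :
    phiTerm [] [0] q x k = q ^ (k * (k - 1)) / qPoch q q k * x ^ k := by
  have h0 : qPoch q 0 k = 1 := by simp [qPoch]
  have h2 : k.choose 2 * 2 = k * (k - 1) := by
    rw [Nat.choose_two_right]
    exact Nat.div_mul_cancel (Nat.even_mul_pred_self k).two_dvd
  have h3 : (1 + (([0] : List ℂ).length : ℤ) - (([] : List ℂ).length : ℤ)) = ((2 : ℕ) : ℤ) := by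
    simp
  have h4 : ((-1 : ℂ) ^ k) ^ 2 = 1 := by rw [← pow_mul, mul_comm, pow_mul]; simp
  rw [phiTerm, h3, zpow_natCast, mul_pow, h4, ← pow_mul, h2]
  simp only [List.map_nil, List.prod_nil, List.map_cons, List.prod_cons, h0, one_mul, mul_one]
  ring

/-- For `0 < q < 1` the series of `0 φ 1 (-; 0; q, x)` converges for every complex `x`. -/
theorem summable_phiTerm_zero_one {q : ℝ} (h0 : 0 < q) (h1 : q < 1) (x : ℂ) :
    Summable (phiTerm [] [0] (q : ℂ) x) := by
  have hq0 : (q : ℂ) ≠ 0 := by exact_mod_cast h0.ne'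
  have hfac : ∀ j : ℕ, (1 - (q : ℂ) * (q : ℂ) ^ j) ≠ 0 := by
    intro j hj
    have h : q * q ^ j < 1 := by
      rw [← pow_succ']
      exact pow_lt_one₀ h0.le h1 (Nat.succ_ne_zero j)
    have h' : (1 - q * q ^ j : ℝ) = 0 := by exact_mod_cast hj
    linarith
  have hP : ∀ k : ℕ, qPoch (q : ℂ) q k ≠ 0 := fun k =>
    Finset.prod_ne_zero_iff.mpr fun j _ => hfac j
  rcases eq_or_ne x 0 with rfl | hx
  · refine summable_of_ne_finset_zero (s := {0}) fun k hk => ?_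
    have hk' : k ≠ 0 := by simpa using hk
    simp [phiTerm_zero_one, hk']
  have hqt : Filter.Tendsto (fun k : ℕ => (q : ℂ) ^ k) Filter.atTop (nhds 0) :=
    tendsto_pow_atTop_nhds_zero_of_norm_lt_one (by simpa [abs_of_pos h0] using h1)
  have hlim : Filter.Tendsto
      (fun k : ℕ => (q : ℂ) ^ k * (q : ℂ) ^ k * x / (1 - (q : ℂ) * (q : ℂ) ^ k))
      Filter.atTop (nhds 0) := by
    have h := ((hqt.mul hqt).mul_const x).div ((hqt.const_mul (q : ℂ)).const_sub 1)
      (by simp)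
    rw [mul_zero, zero_mul, zero_div] at h
    exact h
  refine summable_of_ratio_test_tendsto_lt_one (l := 0) one_pos
    (Filter.Eventually.of_forall fun k => ?_) ?_
  · rw [phiTerm_zero_one]
    exact mul_ne_zero (div_ne_zero (pow_ne_zero _ hq0) (hP k)) (pow_ne_zero _ hx)
  · have hn := hlim.norm
    rw [norm_zero] at hn
    refine hn.congr fun k => ?_
    rw [← norm_div]
    congr 1
    rw [phiTerm_zero_one, phiTerm_zero_one]
    have e1 : (k + 1) * (k + 1 - 1) = k * (k - 1) + (k + k) := by
      cases k with
      | zero => rfl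
      | succ m => simp only [Nat.add_sub_cancel]; ring
    have e2 : qPoch (q : ℂ) q (k + 1) = qPoch (q : ℂ) q k * (1 - (q : ℂ) * (q : ℂ) ^ k) := by
      simp [qPoch, Finset.prod_range_succ]
    rw [e1, e2]
    have a1 := hP k
    have a2 := hfac k
    field_simp
    ring

end QHyp

open Filter Topology ComplexConjugate

namespace QHyp

/-! Write A for `ramanujan q`. Then f_n(z) = A(c/z) and f_{n+1}(z) = A(q²c/z) with c = q^(2n+1), so
everything follows from comparing A(x) with A(q²x). The equation A(x) = A(qx) + x A(q²x), iterated
back from q^N x, where A is near 1, propagates sign conditions to x. For Im x > 0 this gives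
Im(A(x)/A(qx)) > 0 (`ramanujan_sector`), so zeros are real; positivity on x ≥ 0 makes them negative.
Also A(x)/A(q²x) = x + A(qx)/A(q²x) has imaginary part at least Im x. Differentiating this at the
real axis bounds the Wronskian of A(x) and A(q²x) below by A(q²x)² (`sq_le_wronskian`). Hence zeros
are simple, the Wronskian never vanishes, and Rolle gives interlacing. -/

/-- The entire function `0 φ 1 (-; 0; q, x)`. -/
noncomputable def ramanujan (q : ℝ) (x : ℂ) : ℂ :=
  phi [] [0] (q : ℂ) x

theorem f_eq_ramanujan (q : ℝ) (n : ℤ) (z : ℂ) :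
    f q n z = ramanujan q ((q : ℂ) ^ (2 * n + 1) / z) := rfl

theorem ramanujan_zero (q : ℝ) : ramanujan q 0 = 1 := by
  rw [ramanujan, phi, tsum_eq_single 0]
  · simp [phiTerm_zero_one, qPoch]
  · intro k hk
    simp [phiTerm_zero_one, hk]

theorem qPoch_self_ne_zero {q : ℝ} (h0 : 0 < q) (h1 : q < 1) (k : ℕ) :
    qPoch (q : ℂ) q k ≠ 0 := by
  refine Finset.prod_ne_zero_iff.mpr fun j _ hj => ?_
  have h : q * q ^ j < 1 := by
    rw [← pow_succ']
    exact pow_lt_one₀ h0.le h1 (Nat.succ_ne_zero j)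
  have h' : (1 - q * q ^ j : ℝ) = 0 := by exact_mod_cast hj
  linarith

theorem qPoch_succ (q a : ℂ) (k : ℕ) : qPoch q a (k + 1) = qPoch q a k * (1 - a * q ^ k) := by
  simp [qPoch, Finset.prod_range_succ]

theorem conj_ramanujan (q : ℝ) (x : ℂ) : ramanujan q (conj x) = conj (ramanujan q x) := by
  rw [ramanujan, phi, ramanujan, phi, Complex.conj_tsum]
  refine tsum_congr fun k => ?_
  simp [phiTerm_zero_one, qPoch]

theorem ramanujan_ofReal_im (q x : ℝ) : (ramanujan q x).im = 0 := by
  rw [← Complex.conj_eq_iff_im, ← conj_ramanujan, Complex.conj_ofReal]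

theorem ramanujan_ofReal_eq_zero_iff {q x : ℝ} :
    ramanujan q x = 0 ↔ (ramanujan q x).re = 0 := by
  simp [Complex.ext_iff, ramanujan_ofReal_im]

/-! ### The q-difference equation and descent along q^N x -/

variable {q : ℝ}

theorem differentiable_ramanujan (h0 : 0 < q) (h1 : q < 1) :
    Differentiable ℂ (ramanujan q) := by
  intro x
  have hd : DifferentiableOn ℂ (fun w => ∑' k, phiTerm [] [0] (q : ℂ) w k)
      (Metric.ball 0 (‖x‖ + 1)) := by
    refine Complex.differentiableOn_tsum_of_summable_norm
      (summable_phiTerm_zero_one h0 h1 ((‖x‖ + 1 : ℝ) : ℂ)).norm (fun k => ?_)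
      Metric.isOpen_ball fun k w hw => ?_
    · simp only [phiTerm_zero_one]
      fun_prop
    · rw [mem_ball_zero_iff] at hw
      rw [phiTerm_zero_one, phiTerm_zero_one, norm_mul, norm_mul, norm_pow, norm_pow,
        Complex.norm_real, Real.norm_of_nonneg (by positivity)]
      gcongr
  exact hd.differentiableAt (Metric.isOpen_ball.mem_nhds (by simp))

/-- The `q`-difference equation of `0 φ 1 (-; 0; q, x)`. -/
theorem ramanujan_eq_add (h0 : 0 < q) (h1 : q < 1) (x : ℂ) :
    ramanujan q x = ramanujan q (q * x) + x * ramanujan q (q ^ 2 * x) := by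
  have hs := summable_phiTerm_zero_one h0 h1
  simp only [ramanujan, phi]
  -- Term k + 1 at x minus term k + 1 at qx carries the factor 1 - q^(k+1), which cancels and leaves
  -- x times term k at q²x.
  rw [(hs x).tsum_eq_zero_add, (hs (q * x)).tsum_eq_zero_add, ← tsum_mul_left, add_assoc,
    ← ((summable_nat_add_iff 1).mpr (hs (q * x))).tsum_add ((hs (q ^ 2 * x)).mul_left x)]
  refine congrArg₂ (· + ·) ?_ (tsum_congr fun k => ?_)
  · simp [phiTerm_zero_one]
  · have hk := qPoch_self_ne_zero h0 h1 k
    have hk' := qPoch_self_ne_zero h0 h1 (k + 1)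
    have e : (k + 1) * (k + 1 - 1) = k * (k - 1) + 2 * k := by
      cases k with
      | zero => rfl
      | succ m => simp only [Nat.add_sub_cancel]; ring
    rw [qPoch_succ] at hk'
    have hk2 := right_ne_zero_of_mul hk'
    simp only [phiTerm_zero_one, e, qPoch_succ]
    field_simp
    ring

theorem tendsto_pow_mul_zero (h0 : 0 < q) (h1 : q < 1) (x : ℂ) :
    Tendsto (fun N : ℕ => (q : ℂ) ^ N * x) atTop (𝓝 0) := by
  have h := tendsto_pow_atTop_nhds_zero_of_norm_lt_one
    (show ‖(q : ℂ)‖ < 1 by simpa [abs_of_pos h0] using h1)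
  simpa using h.mul_const x

theorem tendsto_ramanujan_pow_mul (h0 : 0 < q) (h1 : q < 1) (x : ℂ) :
    Tendsto (fun N : ℕ => ramanujan q ((q : ℂ) ^ N * x)) atTop (𝓝 1) := by
  have h := ((differentiable_ramanujan h0 h1).continuous.tendsto 0).comp
    (tendsto_pow_mul_zero h0 h1 x)
  rwa [ramanujan_zero] at h

/-- A property of points that holds at `q ^ N x` for large `N`, and passes from `q y` to `y`,
holds at `x`. -/
theorem of_eventually_pow_mul {P : ℂ → Prop} {x : ℂ}
    (hev : ∀ᶠ N : ℕ in atTop, P ((q : ℂ) ^ N * x))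
    (hstep : ∀ N : ℕ, P (q * ((q : ℂ) ^ N * x)) → P ((q : ℂ) ^ N * x)) : P x := by
  obtain ⟨N, hN⟩ := hev.exists
  have h : ∀ M ≤ N, P ((q : ℂ) ^ M * x) := fun M hM =>
    Nat.decreasingInduction (motive := fun M _ => P ((q : ℂ) ^ M * x))
      (fun M _ ih => hstep M (by rwa [← mul_assoc, ← pow_succ'])) hN hM
  simpa using h 0 N.zero_le

/-- Consecutive values of `ramanujan q` along `x, q x, q² x` do not vanish together. -/
theorem ramanujan_ne_zero_or (h0 : 0 < q) (h1 : q < 1) (x : ℂ) :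
    ramanujan q x ≠ 0 ∨ ramanujan q (q * x) ≠ 0 := by
  refine of_eventually_pow_mul (q := q)
    (P := fun y => ramanujan q y ≠ 0 ∨ ramanujan q (q * y) ≠ 0) ?_ fun N hN => ?_
  · filter_upwards [(tendsto_ramanujan_pow_mul h0 h1 x).eventually_ne one_ne_zero] with N hN
    exact Or.inl hN
  · set y := (q : ℂ) ^ N * x with hy
    by_contra! h
    have he := ramanujan_eq_add h0 h1 y
    rw [h.1, h.2, zero_add, eq_comm, mul_eq_zero] at he
    rcases hN with hN | hN
    · exact hN h.2
    · rcases he with he | he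
      · rw [he, ramanujan_zero] at h
        exact one_ne_zero h.1
      · exact hN (by rwa [← mul_assoc, ← sq])

theorem ramanujan_ne_zero_of_eq_zero (h0 : 0 < q) (h1 : q < 1) {x : ℂ}
    (hx : ramanujan q x = 0) : ramanujan q (q ^ 2 * x) ≠ 0 := by
  intro h
  have he := ramanujan_eq_add h0 h1 x
  rw [hx, h, mul_zero, add_zero] at he
  exact (ramanujan_ne_zero_or h0 h1 x).elim (· hx) (· he.symm)

/-- The recurrence has nonnegative coefficients here; being of second order, it needs two
consecutive values in the induction. -/
theorem ramanujan_re_pos (h0 : 0 < q) (h1 : q < 1) {x : ℝ} (hx : 0 ≤ x) :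
    0 < (ramanujan q x).re := by
  have key := of_eventually_pow_mul (q := q) (x := (x : ℂ))
    (P := fun y => 0 < (ramanujan q y).re ∧ 0 < (ramanujan q (q * y)).re) ?_ fun N hN => ?_
  · exact key.1
  · have h : ∀ y : ℂ, ∀ᶠ N : ℕ in atTop, 0 < (ramanujan q ((q : ℂ) ^ N * y)).re := fun y =>
      ((Complex.continuous_re.tendsto 1).comp
        (tendsto_ramanujan_pow_mul h0 h1 y)).eventually_const_lt (by simp)
    filter_upwards [h x, h (q * x)] with N hN hN'
    exact ⟨hN, by rwa [mul_left_comm]⟩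
  · refine ⟨?_, hN.1⟩
    have e : (q : ℂ) ^ N * x = ((q ^ N * x : ℝ) : ℂ) := by push_cast; rfl
    rw [← mul_assoc (q : ℂ) (q : ℂ), ← sq] at hN
    rw [ramanujan_eq_add h0 h1, Complex.add_re]
    rw [e] at hN ⊢
    rw [Complex.re_ofReal_mul]
    have : 0 ≤ q ^ N * x := by positivity
    have := hN.1
    have := hN.2
    positivity

/-! ### The upper half-plane and the location of the zeros -/

theorem inv_im_neg {w : ℂ} (hw : 0 < w.im) : (w⁻¹).im < 0 := by
  rw [Complex.inv_im]
  have : w ≠ 0 := by rintro rfl; simp at hw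
  exact div_neg_of_neg_of_pos (by linarith) (Complex.normSq_pos.mpr this)

/-- In the upper half-plane, the ratio `R = ramanujan q x / ramanujan q (q x)` lies in the
sector between the positive axis and `x`. -/
theorem ramanujan_sector (h0 : 0 < q) (h1 : q < 1) {x : ℂ} (hx : 0 < x.im) :
    ramanujan q x ≠ 0 ∧ ramanujan q (q * x) ≠ 0 ∧
      0 < (ramanujan q x / ramanujan q (q * x)).im ∧
      0 < (x * (ramanujan q (q * x) / ramanujan q x)).im := by
  have hlim := tendsto_ramanujan_pow_mul h0 h1
  have hqim : ∀ N : ℕ, ∀ w : ℂ, ((q : ℂ) ^ N * w).im = q ^ N * w.im := fun N w => by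
    rw [← Complex.ofReal_pow, Complex.im_ofReal_mul]
  refine of_eventually_pow_mul (q := q)
    (P := fun y => ramanujan q y ≠ 0 ∧ ramanujan q (q * y) ≠ 0 ∧
      0 < (ramanujan q y / ramanujan q (q * y)).im ∧
      0 < (y * (ramanujan q (q * y) / ramanujan q y)).im) ?_ fun N hN => ?_
  -- The imaginary parts themselves tend to 0, so q^N is factored out; what remains tends to Im x >
  -- 0.
  · have hratio : ∀ a b : ℂ, ∀ᶠ N : ℕ in atTop,
        0 < (x * (ramanujan q ((q : ℂ) ^ N * a) / ramanujan q ((q : ℂ) ^ N * b))).im := by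
      intro a b
      have h := ((hlim a).div (hlim b) one_ne_zero).const_mul x
      rw [div_one, mul_one] at h
      exact ((Complex.continuous_im.tendsto x).comp h).eventually_const_lt hx
    filter_upwards [(hlim x).eventually_ne one_ne_zero,
      (hlim (q * x)).eventually_ne one_ne_zero, hratio (q ^ 2 * x) (q * x),
      hratio (q * x) x] with N hA hB h2 h3
    have e1 : (q : ℂ) * (q ^ N * x) = q ^ N * (q * x) := by ring
    have e2 : (q : ℂ) ^ 2 * (q ^ N * x) = q ^ N * (q ^ 2 * x) := by ring
    refine ⟨hA, by rwa [e1], ?_, ?_⟩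
    · rw [ramanujan_eq_add h0 h1 (q ^ N * x), e1, e2, add_div, div_self hB, Complex.add_im,
        Complex.one_im, zero_add, mul_assoc, mul_div_assoc, hqim, mul_div_assoc]
      positivity
    · rw [e1, mul_assoc, hqim]
      positivity
  · set y := (q : ℂ) ^ N * x with hy
    have hyim : 0 < y.im := by rw [hy, hqim]; positivity
    have hy0 : y ≠ 0 := by rintro h; simp [h] at hyim
    obtain ⟨hB, hC, h2, h3⟩ := hN
    rw [← mul_assoc (q : ℂ) (q : ℂ), ← sq] at hC h2 h3
    have hA := ramanujan_eq_add h0 h1 y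
    set A := ramanujan q y
    set B := ramanujan q (q * y)
    set C := ramanujan q (q ^ 2 * y)
    rw [mul_assoc, Complex.im_ofReal_mul] at h3
    have h3' : 0 < (y * (C / B)).im := pos_of_mul_pos_right h3 h0.le
    have h4 : 0 < (A / B).im := by
      rw [hA, add_div, div_self hB, Complex.add_im, Complex.one_im, zero_add, mul_div_assoc]
      exact h3'
    have hA0 : A ≠ 0 := by intro h; simp [h] at h4
    refine ⟨hA0, hB, h4, ?_⟩
    -- Both summands lie in the lower half-plane, so the inverse of their sum lies in the upper one.
    have e : y * (B / A) = (y⁻¹ + (B / C)⁻¹)⁻¹ := by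
      have hs : y⁻¹ + (B / C)⁻¹ = A / (y * B) := by
        rw [hA]
        field_simp
      rw [hs]
      field_simp
    have hneg : (y⁻¹ + (B / C)⁻¹).im < 0 := by
      rw [Complex.add_im]
      exact add_neg (inv_im_neg hyim) (inv_im_neg h2)
    rw [e, Complex.inv_im]
    refine div_pos (by linarith) (Complex.normSq_pos.mpr fun h => ?_)
    rw [h, Complex.zero_im] at hneg
    exact hneg.false

theorem ramanujan_ne_zero_of_im_ne_zero (h0 : 0 < q) (h1 : q < 1) {x : ℂ} (hx : x.im ≠ 0) :
    ramanujan q x ≠ 0 := by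
  rcases hx.lt_or_gt with hx | hx
  · have h := (ramanujan_sector h0 h1 (x := conj x) (by simpa using hx)).1
    rwa [conj_ramanujan, Ne, map_eq_zero] at h
  · exact (ramanujan_sector h0 h1 hx).1

/-- The zeros of `0 φ 1 (-; 0; q, x)` are real and negative. -/
theorem eq_ofReal_neg_of_ramanujan_eq_zero (h0 : 0 < q) (h1 : q < 1) {x : ℂ}
    (hx : ramanujan q x = 0) : ∃ r : ℝ, r < 0 ∧ x = r := by
  have him : x.im = 0 := by
    by_contra h
    exact ramanujan_ne_zero_of_im_ne_zero h0 h1 h hx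
  have hxr : x = (x.re : ℂ) := by apply Complex.ext <;> simp [him]
  refine ⟨x.re, ?_, hxr⟩
  by_contra! h
  have := ramanujan_re_pos h0 h1 h
  rw [← hxr, hx] at this
  simp at this

/-- `Im (ramanujan q x / ramanujan q (q² x)) ≥ Im x` in the upper half-plane. -/
theorem im_mul_normSq_le (h0 : 0 < q) (h1 : q < 1) {x : ℂ} (hx : 0 < x.im) :
    x.im * Complex.normSq (ramanujan q (q ^ 2 * x)) ≤
      (ramanujan q x * conj (ramanujan q (q ^ 2 * x))).im := by
  obtain ⟨-, hC, h, -⟩ := ramanujan_sector h0 h1 (x := q * x)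
    (by rw [Complex.im_ofReal_mul]; positivity)
  rw [← mul_assoc (q : ℂ) (q : ℂ), ← sq] at hC h
  rw [ramanujan_eq_add h0 h1 x, add_mul, mul_assoc, Complex.mul_conj, Complex.add_im,
    Complex.im_mul_ofReal]
  set B := ramanujan q (q * x)
  set C := ramanujan q (q ^ 2 * x)
  have e : B * conj C = B / C * (Complex.normSq C : ℂ) := by
    rw [← Complex.mul_conj]
    field_simp
  rw [e, Complex.im_mul_ofReal]
  have := mul_nonneg h.le (Complex.normSq_nonneg C)
  linarith

/-! ### The Wronskian on the real line -/

theorem deriv_nonneg_of_nonneg_right {F : ℝ → ℝ} {d a : ℝ} (hF : HasDerivAt F d a)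
    (ha : F a = 0) (hpos : ∀ y > a, 0 ≤ F y) : 0 ≤ d := by
  have h := hF.hasDerivWithinAt (s := Set.Ioi a)
  rw [hasDerivWithinAt_iff_tendsto_slope' (by simp)] at h
  refine ge_of_tendsto h (eventually_nhdsWithin_of_forall fun y hy => ?_)
  rw [slope_def_field, ha, sub_zero]
  exact div_nonneg (hpos y hy) (sub_nonneg.mpr (le_of_lt hy))

/-- The Wronskian of `ramanujan q x` and `ramanujan q (q² x)` on the real line is bounded below
by the square of the latter. -/
theorem sq_le_wronskian (h0 : 0 < q) (h1 : q < 1) (x : ℝ) :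
    (ramanujan q (q ^ 2 * x)).re ^ 2 ≤
      (deriv (ramanujan q) x).re * (ramanujan q (q ^ 2 * x)).re -
        (ramanujan q x).re * (q ^ 2 * (deriv (ramanujan q) (q ^ 2 * x)).re) := by
  have hline : HasDerivAt (fun y : ℝ => (x : ℂ) + y * Complex.I) Complex.I 0 := by
    simpa using ((Complex.ofRealCLM.hasDerivAt (x := 0)).mul_const Complex.I).const_add (x : ℂ)
  have hd := differentiable_ramanujan h0 h1
  have hp : HasDerivAt (fun y : ℝ => ramanujan q ((x : ℂ) + y * Complex.I))
      (deriv (ramanujan q) x * Complex.I) 0 := by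
    refine HasDerivAt.comp (h₂ := ramanujan q) 0 ?_ hline
    simpa using (hd x).hasDerivAt
  have hr : HasDerivAt (fun y : ℝ => ramanujan q (q ^ 2 * ((x : ℂ) + y * Complex.I)))
      (deriv (ramanujan q) (q ^ 2 * x) * (q ^ 2 * Complex.I)) 0 := by
    refine HasDerivAt.comp (h₂ := ramanujan q) 0 ?_ (hline.const_mul _)
    simpa using (hd (q ^ 2 * x)).hasDerivAt
  have hpre := Complex.reCLM.hasFDerivAt.comp_hasDerivAt (0 : ℝ) hp
  have hpim := Complex.imCLM.hasFDerivAt.comp_hasDerivAt (0 : ℝ) hp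
  have hrre := Complex.reCLM.hasFDerivAt.comp_hasDerivAt (0 : ℝ) hr
  have hrim := Complex.imCLM.hasFDerivAt.comp_hasDerivAt (0 : ℝ) hr
  -- With p = A(x + iy) and r = A(q²(x + iy)), this is F(y) = Im(p r̄) - y|r|². It vanishes at 0 and
  -- is nonnegative for y > 0; F'(0) is the Wronskian minus A(q²x)².
  have hF := ((hpim.mul hrre).sub (hpre.mul hrim)).sub
    ((hasDerivAt_id (0 : ℝ)).mul ((hrre.mul hrre).add (hrim.mul hrim)))
  have e1 : (ramanujan q ((q : ℂ) ^ 2 * x)).im = 0 := by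
    have := ramanujan_ofReal_im q (q ^ 2 * x)
    push_cast at this
    exact this
  have key := deriv_nonneg_of_nonneg_right hF ?_ fun y hy => ?_
  · have e2 : ∀ w : ℂ, (w * ((q : ℂ) ^ 2 * Complex.I)).im = q ^ 2 * w.re := fun w => by
      rw [← Complex.ofReal_pow, mul_left_comm, Complex.im_ofReal_mul]
      simp
    simp [e1, e2, ramanujan_ofReal_im] at key
    linarith
  · simp [e1, ramanujan_ofReal_im]
  · have h := im_mul_normSq_le h0 h1 (x := (x : ℂ) + y * Complex.I) (by simpa using hy)
    simp [Complex.normSq_apply, Complex.mul_im] at h ⊢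
    linarith

theorem deriv_ramanujan_re_ne_zero (h0 : 0 < q) (h1 : q < 1) {x : ℝ}
    (hx : ramanujan q x = 0) : (deriv (ramanujan q) x).re ≠ 0 := by
  intro h
  have hw := sq_le_wronskian h0 h1 x
  have hv := ramanujan_ne_zero_of_eq_zero h0 h1 hx
  rw [h, hx, Complex.zero_re, zero_mul, zero_mul, sub_zero] at hw
  refine hv ?_
  have := ramanujan_ofReal_eq_zero_iff (q := q) (x := q ^ 2 * x)
  push_cast at this
  rw [this]
  nlinarith

/-- The bound by A(q²x)² is strict enough unless A(q²x) = 0; there A(x) ≠ 0, and simplicity of the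
zero q²x finishes. -/
theorem wronskian_ne_zero (h0 : 0 < q) (h1 : q < 1) (x : ℝ) :
    (deriv (ramanujan q) x).re * (ramanujan q (q ^ 2 * x)).re -
        (ramanujan q x).re * (q ^ 2 * (deriv (ramanujan q) (q ^ 2 * x)).re) ≠ 0 := by
  intro h
  have hw := sq_le_wronskian h0 h1 x
  have hv : (ramanujan q (q ^ 2 * x)).re = 0 := by nlinarith
  have hiff := ramanujan_ofReal_eq_zero_iff (q := q) (x := q ^ 2 * x)
  have hder := deriv_ramanujan_re_ne_zero h0 h1 (x := q ^ 2 * x)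
  push_cast at hiff hder
  have hv' := hiff.mpr hv
  rw [hv, mul_zero, zero_sub, neg_eq_zero, mul_eq_zero, mul_eq_zero] at h
  rcases h with h | h | h
  · exact ramanujan_ne_zero_of_eq_zero h0 h1 (ramanujan_ofReal_eq_zero_iff.mpr h) hv'
  · exact (pow_pos h0 2).ne' h
  · exact hder hv' h

/-! ### Interlacing from the Wronskian -/

/-- Between two zeros of `u` there is a zero of `v`, if the Wronskian of `u` and `v` has no
zero. -/
theorem exists_zero_between {u v u' v' : ℝ → ℝ} (hu : ∀ x, HasDerivAt u (u' x) x)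
    (hv : ∀ x, HasDerivAt v (v' x) x) (hw : ∀ x, u' x * v x - u x * v' x ≠ 0) {a b : ℝ}
    (hab : a < b) (ha : u a = 0) (hb : u b = 0) : ∃ c, v c = 0 ∧ a < c ∧ c < b := by
  by_contra! h
  have hne : ∀ c ∈ Set.Icc a b, v c ≠ 0 := by
    rintro c ⟨hac, hcb⟩ hc
    rcases hac.eq_or_lt with rfl | hac
    · exact hw a (by simp [ha, hc])
    · rcases hcb.eq_or_lt with rfl | hcb
      · exact hw c (by simp [hb, hc])
      · exact absurd hcb (not_lt.mpr (h c hc hac))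
  have hd : ∀ c ∈ Set.Icc a b,
      HasDerivAt (fun x => u x / v x) ((u' c * v c - u c * v' c) / v c ^ 2) c :=
    fun c hc => (hu c).div (hv c) (hne c hc)
  -- Rolle for u/v, whose derivative is the Wronskian over v².
  obtain ⟨c, hc, hc'⟩ := exists_hasDerivAt_eq_zero hab
    (fun c hc => (hd c hc).continuousAt.continuousWithinAt) (by simp [ha, hb])
    fun c hc => hd c (Set.Ioo_subset_Icc_self hc)
  exact div_ne_zero (hw c) (pow_ne_zero 2 (hne c (Set.Ioo_subset_Icc_self hc))) hc'

theorem interlace_of_wronskian_ne_zero {u v u' v' : ℝ → ℝ} (hu : ∀ x, HasDerivAt u (u' x) x)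
    (hv : ∀ x, HasDerivAt v (v' x) x) (hw : ∀ x, u' x * v x - u x * v' x ≠ 0) :
    Interlace {x | u x = 0} {x | v x = 0} := by
  refine ⟨Set.disjoint_left.mpr fun x hx hx' => hw x ?_, fun a ha b hb hab => ?_,
    fun a ha b hb hab => ?_⟩
  · rw [Set.mem_ofPred_eq] at hx hx'
    simp [hx, hx']
  · exact exists_zero_between hu hv hw hab ha hb
  · refine exists_zero_between hv hu (fun x h => hw x ?_) hab ha hb
    linarith

theorem interlace_ramanujan (h0 : 0 < q) (h1 : q < 1) :
    Interlace {x : ℝ | ramanujan q x = 0} {x : ℝ | ramanujan q ((q ^ 2 * x : ℝ) : ℂ) = 0} := by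
  have hd := differentiable_ramanujan h0 h1
  have hu : ∀ x : ℝ, HasDerivAt (fun x : ℝ => (ramanujan q x).re)
      ((deriv (ramanujan q) x).re) x := fun x => (hd x).hasDerivAt.real_of_complex
  have h := interlace_of_wronskian_ne_zero hu
    (v := fun x : ℝ => (ramanujan q ((q ^ 2 * x : ℝ) : ℂ)).re)
    (v' := fun x => q ^ 2 * (deriv (ramanujan q) (q ^ 2 * x)).re) (fun x => ?_) fun x => ?_
  · simpa only [← ramanujan_ofReal_eq_zero_iff] using h
  · have := (hu (q ^ 2 * x)).comp x ((hasDerivAt_id x).const_mul (q ^ 2))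
    simpa [Function.comp_def, mul_comm] using this
  · have := wronskian_ne_zero h0 h1 x
    push_cast
    exact this

/-! ### Transfer to f_n by x ↦ c / x -/

/-- Interlacing of sets of negative numbers is preserved by `x ↦ c / x`, `c > 0`. -/
theorem Interlace.div {S T S' T' : Set ℝ} {c : ℝ} (hc : 0 < c) (h : Interlace S T)
    (hS : ∀ x, x ∈ S' ↔ x < 0 ∧ c / x ∈ S) (hT : ∀ x, x ∈ T' ↔ x < 0 ∧ c / x ∈ T)
    (hS0 : ∀ x ∈ S, x < 0) (hT0 : ∀ x ∈ T, x < 0) : Interlace S' T' := by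
  have aux : ∀ {S T S' T' : Set ℝ}, (∀ a ∈ S, ∀ b ∈ S, a < b → ∃ t ∈ T, a < t ∧ t < b) →
      (∀ x, x ∈ S' ↔ x < 0 ∧ c / x ∈ S) → (∀ x, x ∈ T' ↔ x < 0 ∧ c / x ∈ T) →
      (∀ x ∈ T, x < 0) → ∀ a ∈ S', ∀ b ∈ S', a < b → ∃ t ∈ T', a < t ∧ t < b := by
    intro S T S' T' h hS hT hT0 a ha b hb hab
    rw [hS] at ha hb
    have hlt : ∀ {x y : ℝ}, x < 0 → y < 0 → x < y → c / y < c / x := by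
      intro x y hx hy hxy
      rw [div_lt_iff_of_neg hy, div_mul_eq_mul_div, div_lt_iff_of_neg hx]
      exact mul_lt_mul_of_pos_left hxy hc
    -- The involution reverses order on the negative axis, so a and b swap roles.
    obtain ⟨t, ht, h1, h2⟩ := h _ hb.2 _ ha.2 (hlt ha.1 hb.1 hab)
    have ht0 := hT0 t ht
    have e : ∀ x : ℝ, c / (c / x) = x := fun x => div_div_cancel₀ hc.ne'
    have hn : ∀ {x : ℝ}, x < 0 → c / x < 0 := fun hx => div_neg_of_pos_of_neg hc hx
    refine ⟨c / t, (hT _).mpr ⟨hn ht0, by rwa [e]⟩, ?_, ?_⟩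
    · simpa only [e] using hlt ht0 (hn ha.1) h2
    · simpa only [e] using hlt (hn hb.1) ht0 h1
  refine ⟨Set.disjoint_left.mpr fun x hx hx' => ?_, aux h.2.1 hS hT hT0, aux h.2.2 hT hS hS0⟩
  exact Set.disjoint_left.mp h.1 ((hS x).mp hx).2 ((hT x).mp hx').2

theorem mem_realZeros_iff (h0 : 0 < q) (h1 : q < 1) (n : ℤ) (x : ℝ) :
    x ∈ realZeros q n ↔ x < 0 ∧ ramanujan q ((q ^ (2 * n + 1) / x : ℝ) : ℂ) = 0 := by
  have hc : 0 < q ^ (2 * n + 1) := zpow_pos h0 _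
  rw [realZeros, Set.mem_ofPred_eq, zeros, Set.mem_ofPred_eq, f_eq_ramanujan]
  push_cast
  refine and_congr_left fun h => ⟨fun hx => ?_, fun hx => by exact_mod_cast hx.ne⟩
  obtain ⟨r, hr, hxr⟩ := eq_ofReal_neg_of_ramanujan_eq_zero h0 h1 h
  have : q ^ (2 * n + 1) / x = r := by exact_mod_cast hxr
  rw [← this] at hr
  by_contra! hx'
  exact absurd hr (not_lt.mpr (by positivity))

theorem interlace_realZeros (h0 : 0 < q) (h1 : q < 1) (n : ℤ) :
    Interlace (realZeros q n) (realZeros q (n + 1)) := by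
  have hneg : ∀ x : ℝ, ramanujan q x = 0 → x < 0 := fun x hx => by
    obtain ⟨r, hr, hxr⟩ := eq_ofReal_neg_of_ramanujan_eq_zero h0 h1 hx
    rwa [Complex.ofReal_inj.mp hxr]
  refine (interlace_ramanujan h0 h1).div (zpow_pos h0 (2 * n + 1)) (mem_realZeros_iff h0 h1 n)
    (fun x => ?_) hneg fun x hx => ?_
  -- Uses q² q^(2n+1) = q^(2(n+1)+1).
  · rw [mem_realZeros_iff h0 h1, Set.mem_ofPred_eq, ← mul_div_assoc, ← zpow_natCast,
      ← zpow_add₀ h0.ne']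
    congr! 6
    push_cast
    ring
  · exact neg_of_mul_neg_right (hneg _ hx) (by positivity)

theorem analyticOrderAt_f_eq_one (h0 : 0 < q) (h1 : q < 1) (n : ℤ) {z : ℂ} (hz : z ≠ 0)
    (hf : f q n z = 0) : analyticOrderAt (f q n) z = 1 := by
  have hd := differentiable_ramanujan h0 h1
  set c : ℂ := (q : ℂ) ^ (2 * n + 1) with hc
  have hc0 : c ≠ 0 := zpow_ne_zero _ (by exact_mod_cast h0.ne')
  have han : AnalyticAt ℂ (f q n) z := by
    change AnalyticAt ℂ (ramanujan q ∘ fun z => c / z) z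
    exact (hd.analyticAt _).comp (analyticAt_const.div analyticAt_id hz)
  refine han.analyticOrderAt_eq_one_of_zero_deriv_ne_zero hf ?_
  have hdiv : HasDerivAt (fun z : ℂ => c / z) (-c / z ^ 2) z := by
    simpa using (hasDerivAt_const z c).fun_div (hasDerivAt_id' z) hz
  have hder : HasDerivAt (f q n) (deriv (ramanujan q) (c / z) * (-c / z ^ 2)) z :=
    (hd (c / z)).hasDerivAt.comp z hdiv
  rw [hder.deriv]
  rw [f_eq_ramanujan, ← hc] at hf
  obtain ⟨r, -, hr⟩ := eq_ofReal_neg_of_ramanujan_eq_zero h0 h1 hf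
  refine mul_ne_zero (fun h => ?_) (div_ne_zero (neg_ne_zero.mpr hc0) (pow_ne_zero 2 hz))
  rw [hr] at hf h
  exact deriv_ramanujan_re_ne_zero h0 h1 hf (by simp [h])

theorem im_eq_zero_and_re_neg_of_mem_zeros (h0 : 0 < q) (h1 : q < 1) (n : ℤ) {z : ℂ}
    (hz : z ∈ zeros q n) : z.im = 0 ∧ z.re < 0 := by
  obtain ⟨hz0, hf⟩ := hz
  rw [f_eq_ramanujan] at hf
  obtain ⟨r, hr, hzr⟩ := eq_ofReal_neg_of_ramanujan_eq_zero h0 h1 hf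
  have hz' : z = ((q ^ (2 * n + 1) / r : ℝ) : ℂ) := by
    push_cast
    rw [← hzr, div_div_cancel₀ (zpow_ne_zero _ (by exact_mod_cast h0.ne'))]
  rw [hz', Complex.ofReal_im, Complex.ofReal_re]
  exact ⟨rfl, div_neg_of_pos_of_neg (zpow_pos h0 _) hr⟩

end QHyp

theorem mainTheorem4 (q : ℝ) (hq0 : 0 < q) (hq1 : q < 1) (n : ℤ) :
    (∀ z ∈ QHyp.zeros q n,
      z.im = 0 ∧ z.re < 0 ∧ analyticOrderAt (QHyp.f q n) z = 1) ∧
    QHyp.Interlace (QHyp.realZeros q n) (QHyp.realZeros q (n + 1)) := by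
  refine ⟨fun z hz => ?_, QHyp.interlace_realZeros hq0 hq1 n⟩
  obtain ⟨him, hre⟩ := QHyp.im_eq_zero_and_re_neg_of_mem_zeros hq0 hq1 n hz
  exact ⟨him, hre, QHyp.analyticOrderAt_f_eq_one hq0 hq1 n hz.1 hz.2⟩
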